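/- Let $\mathcal H$ be a complex Hilbert space with an orthonormal basis $(\varphi_n)_{n\in A}$, where $A=\mathbb Z^d$ or $A=\mathbb Z_+^d$ for some integer $d\ge 1$ (for $\mathbb Z_+$ one may take either the nonnegative or the positive integers). Let $U$ be a unitary operator on $\mathcal H$ and let $\psi\in\mathcal H$ with $\|\psi\|=1$. For $n\in A$ put $|n|=|n_1|+\dots+|n_d|$, and for $p>0$ and integers $K\ge 1$ put $$\langle |X|^p_\psi\rangle(K)=\frac1K\sum_{k=0}^{K-1}\ \sum_{n\in A}\left(|n|^p+1\right)\left|\langle\varphi_n,U^k\psi\rangle\right|^2\in[0,\infty].$$ For $\phi\in\mathcal H$ let $\mu_\phi$ be the spectral measure of $U$ and $\phi$, that is, the finite Borel measure on the unit circle $\partial\mathbb D$ with $\langle\phi,f(U)\phi\rangle=\int f\,d\mu_\phi$ for every continuous $f:\partial\mathbb D\to\mathbb C$. For $\alpha\in[0,1]$ let $\mathcal H_{\alpha c}$ be the closed subspace of all $\phi\in\mathcal H$ whose spectral measure is $\alpha$-continuous, which means that $\mu_\phi(E)=0$ for every $E\subseteq\partial\mathbb D$ of $\alpha$-dimensional Hausdorff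 measure zero, and let $P_{\alpha c}$ be the orthogonal projection of $\mathcal H$ onto $\mathcal H_{\alpha c}$. Suppose that $P_{\alpha c}\psi\neq 0$ for some $\alpha\in[0,1]$. Then for each $p>0$ the following holds. - If $\alpha<1$, there is a constant $C>0$, independent of $K$, such that for every integer $K\ge 1$, $$\langle |X|^p_\psi\rangle(K)>C\,K^{\alpha p/d}.$$ - If $\alpha=1$, there is a constant $C>0$, independent of $K$, such that for every integer $K\ge 2$, $$\langle |X|^p_\psi\rangle(K)>C\left(\frac{K}{\log K}\right)^{p/d}.$$ -/

import Mathlib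

open MeasureTheory
open scoped ENNReal

namespace UnitaryDynamics

/-- The unit circle `∂𝔻 ⊆ ℂ`, with the metric and the Borel structure inherited from `ℂ`. -/
abbrev UnitCircle : Type := Metric.sphere (0 : ℂ) 1

section SpectralMeasure

variable {H : Type*} [NormedAddCommGroup H] [InnerProductSpace ℂ H] [CompleteSpace H]

/-- The inclusion of the spectrum of a unitary operator into the unit circle. -/
noncomputable def spectrumToCircle (U : unitary (H →L[ℂ] H)) :
    C(spectrum ℂ (U : H →L[ℂ] H), UnitCircle) where
  toFun z := ⟨z, Unitary.spectrum_subset_circle U z.2⟩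
  continuous_toFun := Continuous.subtype_mk continuous_subtype_val _

/-- The operator `g(U)` for a continuous function `g` on the unit circle, through the
continuous functional calculus of the unitary (hence normal) operator `U`. -/
noncomputable def functionOf (U : unitary (H →L[ℂ] H)) :
    C(UnitCircle, ℂ) →⋆ₐ[ℂ] (H →L[ℂ] H) :=
  (cfcHom (R := ℂ) (p := IsStarNormal) (Unitary.coe_isStarNormal U)).comp
    (ContinuousMap.compStarAlgHom' ℂ ℂ (spectrumToCircle U))

/-- A compactly supported real function on the circle, as a continuous complex function. -/
noncomputable def complexify (f : CompactlySupportedContinuousMap UnitCircle ℝ) : C(UnitCircle, ℂ) where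
  toFun z := (f z : ℂ)
  continuous_toFun := Complex.continuous_ofReal.comp f.continuous

theorem inner_functionOf_nonneg (U : unitary (H →L[ℂ] H)) (ψ : H)
    (f : CompactlySupportedContinuousMap UnitCircle ℝ) (hf : 0 ≤ f) :
    0 ≤ (inner ℂ ψ (functionOf U (complexify f) ψ)).re := by
  let r : C(UnitCircle, ℂ) := ⟨fun z => ((Real.sqrt (f z) : ℝ) : ℂ),
    Complex.continuous_ofReal.comp (Real.continuous_sqrt.comp f.continuous)⟩
  have hr : complexify f = star r * r := by
    ext z
    have h0 : 0 ≤ f z := hf z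
    simp only [complexify, ContinuousMap.coe_mk, ContinuousMap.mul_apply,
      ContinuousMap.star_apply, r, Complex.star_def, Complex.conj_ofReal]
    rw [← Complex.ofReal_mul, Real.mul_self_sqrt h0]
  rw [hr, map_mul, map_star, ContinuousLinearMap.star_eq_adjoint, mul_apply_eq_comp,
    ContinuousLinearMap.adjoint_inner_right]
  exact inner_self_nonneg (𝕜 := ℂ)

/-- The positive linear functional `f ↦ ⟨ψ, f(U) ψ⟩` on real continuous functions on the circle. -/
noncomputable def spectralFunctional (U : unitary (H →L[ℂ] H)) (ψ : H) :
    CompactlySupportedContinuousMap UnitCircle ℝ →ₚ[ℝ] ℝ :=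
  PositiveLinearMap.mk₀
    { toFun := fun f => (inner ℂ ψ (functionOf U (complexify f) ψ)).re
      map_add' := by
        intro f g
        have h : complexify (f + g) = complexify f + complexify g := by
          ext z; simp [complexify]
        rw [h, map_add, add_apply, inner_add_right, Complex.add_re]
      map_smul' := by
        intro c f
        have h : complexify (c • f) = (c : ℂ) • complexify f := by
          ext z; simp [complexify]
        rw [h, map_smul, smul_apply, inner_smul_right, Complex.re_ofReal_mul]
        simp }
    (inner_functionOf_nonneg U ψ)

/-- The spectral measure `μ_ψ` of the unitary operator `U` and the vector `ψ`: the Borel measure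
on the circle that represents `f ↦ ⟨ψ, f(U) ψ⟩`. -/
noncomputable def spectralMeasure (U : unitary (H →L[ℂ] H)) (ψ : H) : Measure UnitCircle :=
  RealRMK.rieszMeasure (spectralFunctional U ψ)

instance (U : unitary (H →L[ℂ] H)) (ψ : H) : (spectralMeasure U ψ).Regular :=
  RealRMK.regular_rieszMeasure _

instance (U : unitary (H →L[ℂ] H)) (ψ : H) : IsFiniteMeasure (spectralMeasure U ψ) :=
  ⟨isCompact_univ.measure_lt_top⟩

theorem integral_spectralMeasure_real (U : unitary (H →L[ℂ] H)) (ψ : H)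
    (f : CompactlySupportedContinuousMap UnitCircle ℝ) :
    ∫ z, f z ∂(spectralMeasure U ψ) = (inner ℂ ψ (functionOf U (complexify f) ψ)).re :=
  RealRMK.integral_rieszMeasure (spectralFunctional U ψ) f

/-- The defining property of the spectral measure: `⟨ψ, g(U) ψ⟩ = ∫ g dμ_ψ`. -/
theorem inner_functionOf_eq_integral (U : unitary (H →L[ℂ] H)) (ψ : H) (g : C(UnitCircle, ℂ)) :
    inner ℂ ψ (functionOf U g ψ) = ∫ z, g z ∂(spectralMeasure U ψ) := by
  have key : ∀ f : CompactlySupportedContinuousMap UnitCircle ℝ,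
      inner ℂ ψ (functionOf U (complexify f) ψ) =
        ((∫ z, f z ∂(spectralMeasure U ψ) : ℝ) : ℂ) := by
    intro f
    rw [integral_spectralMeasure_real]
    have hs : star (complexify f) = complexify f := by
      ext z; simp [complexify]
    have hA : ContinuousLinearMap.adjoint (functionOf U (complexify f)) =
        functionOf U (complexify f) := by
      rw [← ContinuousLinearMap.star_eq_adjoint, ← map_star, hs]
    refine (Complex.conj_eq_iff_re.mp ?_).symm
    rw [inner_conj_symm, ← ContinuousLinearMap.adjoint_inner_right, hA]
  let fr : CompactlySupportedContinuousMap UnitCircle ℝ :=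
    ⟨⟨fun z => (g z).re, Complex.continuous_re.comp g.continuous⟩,
      HasCompactSupport.of_compactSpace _⟩
  let fi : CompactlySupportedContinuousMap UnitCircle ℝ :=
    ⟨⟨fun z => (g z).im, Complex.continuous_im.comp g.continuous⟩,
      HasCompactSupport.of_compactSpace _⟩
  have hg : g = complexify fr + Complex.I • complexify fi := by
    ext z
    have := Complex.re_add_im (g z)
    rw [mul_comm] at this
    exact this.symm
  have hint : Integrable (fun z => g z) (spectralMeasure U ψ) :=
    g.continuous.integrable_of_hasCompactSupport (HasCompactSupport.of_compactSpace _)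
  have h1 : inner ℂ ψ (functionOf U g ψ) =
      ((∫ z, fr z ∂(spectralMeasure U ψ) : ℝ) : ℂ) +
        Complex.I * ((∫ z, fi z ∂(spectralMeasure U ψ) : ℝ) : ℂ) := by
    conv_lhs => rw [hg]
    rw [map_add, map_smul, add_apply, smul_apply,
      inner_add_right, inner_smul_right, key, key]
  rw [h1, ← integral_re_add_im (𝕜 := ℂ) hint, mul_comm]
  rfl

/-- The total mass of the spectral measure is `‖ψ‖²`. -/
theorem spectralMeasure_univ (U : unitary (H →L[ℂ] H)) (ψ : H) :
    spectralMeasure U ψ Set.univ = ENNReal.ofReal (‖ψ‖ ^ 2) := by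
  have h := inner_functionOf_eq_integral U ψ 1
  rw [map_one, one_apply_eq_self, inner_self_eq_norm_sq_to_K] at h
  simp only [ContinuousMap.one_apply, integral_const, mul_one,
    Complex.real_smul] at h
  have h' : ‖ψ‖ ^ 2 = (spectralMeasure U ψ).real Set.univ := by
    exact Complex.ofReal_injective (by simpa using h)
  rw [h', ofReal_measureReal]

/-- The parallelogram identity for spectral measures. -/
theorem spectralMeasure_add_sub (U : unitary (H →L[ℂ] H)) (φ ψ : H) :
    spectralMeasure U (φ + ψ) + spectralMeasure U (φ - ψ) =
      (2 : ℝ≥0∞) • (spectralMeasure U φ + spectralMeasure U ψ) := by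
  have : IsFiniteMeasure ((2 : ℝ≥0∞) • (spectralMeasure U φ + spectralMeasure U ψ)) :=
    ⟨by rw [Measure.smul_apply, smul_eq_mul]
        exact ENNReal.mul_lt_top (by simp) (measure_lt_top _ _)⟩
  apply ext_of_forall_integral_eq_of_IsFiniteMeasure
  intro f
  let F : CompactlySupportedContinuousMap UnitCircle ℝ :=
    ⟨f.toContinuousMap, HasCompactSupport.of_compactSpace _⟩
  have hi : ∀ χ : H, Integrable (fun z => f z) (spectralMeasure U χ) := fun χ => f.integrable _
  have hF : ∀ χ : H, ∫ z, f z ∂(spectralMeasure U χ) =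
      (inner ℂ χ (functionOf U (complexify F) χ)).re :=
    fun χ => integral_spectralMeasure_real U χ F
  rw [integral_add_measure (hi _) (hi _), integral_smul_measure,
    integral_add_measure (hi _) (hi _), hF, hF, hF, hF, ← Complex.add_re]
  simp only [map_add, map_sub, inner_add_left, inner_add_right, inner_sub_left, inner_sub_right,
    Complex.add_re, Complex.sub_re, ENNReal.toReal_ofNat, smul_eq_mul]
  ring

theorem spectralMeasure_add_le (U : unitary (H →L[ℂ] H)) (φ ψ : H) (E : Set UnitCircle) :
    spectralMeasure U (φ + ψ) E ≤ 2 * (spectralMeasure U φ E + spectralMeasure U ψ E) := by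
  have h := congrArg (fun μ : Measure UnitCircle => μ E) (spectralMeasure_add_sub U φ ψ)
  simp only [Measure.add_apply, Measure.smul_apply, smul_eq_mul] at h
  exact h ▸ le_self_add

theorem spectralMeasure_smul (U : unitary (H →L[ℂ] H)) (c : ℂ) (ψ : H) :
    spectralMeasure U (c • ψ) = ENNReal.ofReal (‖c‖ ^ 2) • spectralMeasure U ψ := by
  have : IsFiniteMeasure (ENNReal.ofReal (‖c‖ ^ 2) • spectralMeasure U ψ) :=
    ⟨by rw [Measure.smul_apply, smul_eq_mul]
        exact ENNReal.mul_lt_top (by simp) (measure_lt_top _ _)⟩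
  apply ext_of_forall_integral_eq_of_IsFiniteMeasure
  intro f
  let F : CompactlySupportedContinuousMap UnitCircle ℝ :=
    ⟨f.toContinuousMap, HasCompactSupport.of_compactSpace _⟩
  have hF : ∀ χ : H, ∫ z, f z ∂(spectralMeasure U χ) =
      (inner ℂ χ (functionOf U (complexify F) χ)).re :=
    fun χ => integral_spectralMeasure_real U χ F
  rw [integral_smul_measure, hF, hF, map_smul, inner_smul_left, inner_smul_right, ← mul_assoc,
    Complex.conj_mul', ENNReal.toReal_ofReal (by positivity), ← Complex.ofReal_pow,
    Complex.re_ofReal_mul, smul_eq_mul]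

/-- A measure on the circle is `α`-continuous if it vanishes on every set of zero
`α`-dimensional Hausdorff measure. -/
def IsAlphaContinuous (α : ℝ) (μ : Measure UnitCircle) : Prop :=
  ∀ E : Set UnitCircle, (μH[α] : Measure UnitCircle) E = 0 → μ E = 0

/-- The subspace `H_{αc}` of all vectors whose spectral measure is `α`-continuous. -/
noncomputable def alphaContinuousSubspace (U : unitary (H →L[ℂ] H)) (α : ℝ) :
    Submodule ℂ H where
  carrier := {ψ | IsAlphaContinuous α (spectralMeasure U ψ)}
  add_mem' := by
    intro φ ψ hφ hψ E hE
    have h := spectralMeasure_add_le U φ ψ E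
    rw [hφ E hE, hψ E hE] at h
    simpa using h
  zero_mem' := by
    intro E _
    have h := spectralMeasure_univ U (0 : H)
    simp only [norm_zero, ne_eq, OfNat.ofNat_ne_zero, not_false_eq_true, zero_pow,
      ENNReal.ofReal_zero] at h
    exact measure_mono_null (Set.subset_univ E) h
  smul_mem' := by
    intro c ψ hψ E hE
    rw [spectralMeasure_smul, Measure.smul_apply, hψ E hE, smul_zero]

theorem isClosed_alphaContinuousSubspace (U : unitary (H →L[ℂ] H)) (α : ℝ) :
    IsClosed (alphaContinuousSubspace U α : Set H) := by
  rw [← isSeqClosed_iff_isClosed]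
  intro u ψ hu hlim E hE
  have hle : ∀ n, spectralMeasure U ψ E ≤ 2 * ENNReal.ofReal (‖ψ - u n‖ ^ 2) := by
    intro n
    have h := spectralMeasure_add_le U (ψ - u n) (u n) E
    rw [sub_add_cancel, hu n E hE, add_zero] at h
    refine h.trans ?_
    gcongr
    rw [← spectralMeasure_univ U]
    exact measure_mono (Set.subset_univ E)
  have h1 : Filter.Tendsto (fun n => ‖ψ - u n‖ ^ 2) Filter.atTop (nhds 0) := by
    have h2 := (tendsto_const_nhds (x := ψ)).sub hlim
    rw [sub_self] at h2
    simpa using h2.norm.pow 2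
  have h3 : Filter.Tendsto (fun n => 2 * ENNReal.ofReal (‖ψ - u n‖ ^ 2)) Filter.atTop
      (nhds 0) := by
    have h4 := ENNReal.Tendsto.const_mul (a := 2) (ENNReal.tendsto_ofReal h1) (Or.inr (by simp))
    simpa using h4
  exact le_antisymm (ge_of_tendsto' h3 hle) bot_le

instance (U : unitary (H →L[ℂ] H)) (α : ℝ) :
    (alphaContinuousSubspace U α).HasOrthogonalProjection :=
  haveI : CompleteSpace (alphaContinuousSubspace U α) :=
    (isClosed_alphaContinuousSubspace U α).completeSpace_coe
  inferInstance

/-- The orthogonal projection `P_{αc}` of `H` onto the subspace `H_{αc}`. -/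
noncomputable def alphaContinuousProjection (U : unitary (H →L[ℂ] H)) (α : ℝ) : H →L[ℂ] H :=
  (alphaContinuousSubspace U α).starProjection

end SpectralMeasure

section Moments

variable {H : Type*} [NormedAddCommGroup H] [InnerProductSpace ℂ H] [CompleteSpace H]
  {d : ℕ} {A : Set (Fin d → ℤ)}

/-- The `ℓ¹` norm `|n| = |n₁| + ⋯ + |n_d|` of a lattice point. -/
noncomputable def latticeNorm (n : Fin d → ℤ) : ℝ := ∑ i, |(n i : ℝ)|

/-- The probability `a_ψ(n, k) = |⟨φ_n, U^k ψ⟩|²` of the state `φ_n` at time `k`. -/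
noncomputable def stateProbability (U : unitary (H →L[ℂ] H)) (φ : HilbertBasis A ℂ H) (ψ : H)
    (n : A) (k : ℕ) : ℝ :=
  ‖inner ℂ (φ n) (((U : H →L[ℂ] H) ^ k) ψ)‖ ^ 2

/-- The moment `|X|^p_ψ(k) = ∑ₙ (|n|^p + 1) a_ψ(n, k)`, a sum of nonnegative terms with values
in `[0, ∞]`. -/
noncomputable def moment (U : unitary (H →L[ℂ] H)) (φ : HilbertBasis A ℂ H) (ψ : H) (p : ℝ)
    (k : ℕ) : ℝ≥0∞ :=
  ∑' n : A, ENNReal.ofReal ((latticeNorm (n : Fin d → ℤ) ^ p + 1) * stateProbability U φ ψ n k)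

/-- The Cesàro average `⟨f⟩(K) = (1 / K) ∑_{j < K} f(j)`. -/
noncomputable def cesaroAverage (f : ℕ → ℝ≥0∞) (K : ℕ) : ℝ≥0∞ :=
  (∑ j ∈ Finset.range K, f j) / (K : ℝ≥0∞)

end Moments

end UnitaryDynamics

/-! The argument follows Guarneri, Combes and Last: a state whose spectral measure has an
`α`-continuous part cannot stay in a small set of sites.

By a covering argument of Rogers and Taylor
(`hausdorffMeasure_compl_iUnion_growthSet`, `IsAlphaContinuous.exists_growthSet`), an
`α`-continuous finite measure `μ` obeys `μ (B(x, r)) ≤ B r ^ α` at all points `x` of a closed set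
`E` of almost full measure. On `E`, Schur's test (`integral_norm_sq_sum_le_of_kernel`) bounds the
`L²(μ)`-norm of trigonometric polynomials by the `ℓ²`-norm of their coefficients. By duality a
vector `ψ₁` that is spectrally supported in `E` satisfies
`∑_{k < K} |⟨χ, U ^ k ψ₁⟩|² ≤ Q K ^ (1 - α) ‖χ‖²` for every `χ`
(`exists_near_sum_norm_inner_sq_le`).

Polynomials `∑ c_{ij} z ^ (i + j)` with `i < K`, `j < 2K` are used, because their kernel is a
product of two Dirichlet kernels, hence `O(dist ^ (-2))`. A single Dirichlet kernel would cost
a logarithm at `α = 1`; with the product the bound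
`K ^ (α p / d)` holds for all `0 ≤ α ≤ 1`, and it implies the one with `K / log K`.

The vector `ψ₁ = χ_E(U) P_{αc} ψ` would require the Borel functional calculus. Since the estimates
only have to be uniform in `K`, it is replaced for each `K` by `g(U) P_{αc} ψ`, with a continuous
`g` close enough to `χ_E`.

As `P_{αc} ψ ≠ 0`, the vector `ψ₁` can be chosen with `‖ψ - ψ₁‖ ≤ r < 1 = ‖ψ‖`. On a box of
`O(R ^ d)` sites the averaged probability is then at most
`(1 + t) r² + O(R ^ d K ^ (-α))`, which stays away from `1` if `R = c K ^ (α / d)` with `c` small,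
and Chebyshev's inequality gives the moment bound (`exists_lt_cesaroAverage_moment`). -/

namespace UnitaryDynamics

/-! ### Hölder growth of `α`-continuous measures -/

section Growth

variable {X : Type*} [MetricSpace X] [MeasurableSpace X]

/-- The set of points `x` at which `μ` obeys the growth bound `μ (B(x, r)) ≤ B r ^ α` at every
scale `r > 0`. -/
def growthSet (μ : Measure X) (α B : ℝ) : Set X :=
  {x | ∀ r : ℝ, 0 < r → μ (Metric.ball x r) ≤ ENNReal.ofReal (B * r ^ α)}

theorem growthSet_mono (μ : Measure X) (α : ℝ) : Monotone (growthSet μ α) := by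
  intro B B' h x hx r hr
  refine (hx r hr).trans (ENNReal.ofReal_le_ofReal ?_)
  have := Real.rpow_nonneg hr.le α
  gcongr

theorem isOpen_lt_measure_ball (μ : Measure X) (c : ℝ≥0∞) (r : ℝ) :
    IsOpen {x | c < μ (Metric.ball x r)} := by
  rw [Metric.isOpen_iff]
  intro x hx
  have hU : Metric.ball x r = ⋃ n : ℕ, Metric.ball x (r - 1 / ((n : ℝ) + 1)) := by
    ext y
    simp only [Metric.mem_ball, Set.mem_iUnion]
    constructor
    · intro h
      obtain ⟨n, hn⟩ := exists_nat_one_div_lt (sub_pos.2 h)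
      exact ⟨n, by linarith⟩
    · rintro ⟨n, hn⟩
      have : (0 : ℝ) < 1 / ((n : ℝ) + 1) := by positivity
      linarith
  have hmono : Monotone fun n : ℕ => Metric.ball x (r - 1 / ((n : ℝ) + 1)) := by
    intro n m hnm
    apply Metric.ball_subset_ball
    have := one_div_le_one_div_of_le (by positivity : (0 : ℝ) < n + 1)
      (by exact_mod_cast Nat.succ_le_succ hnm : (n : ℝ) + 1 ≤ m + 1)
    linarith
  have hx' : c < μ (Metric.ball x r) := hx
  rw [hU, hmono.measure_iUnion, lt_iSup_iff] at hx'
  obtain ⟨n, hn⟩ := hx'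
  refine ⟨1 / ((n : ℝ) + 1), by positivity, fun y hy => hn.trans_le (measure_mono ?_)⟩
  apply Metric.ball_subset_ball'
  rw [Metric.mem_ball, dist_comm] at hy
  linarith

theorem isClosed_growthSet (μ : Measure X) (α B : ℝ) : IsClosed (growthSet μ α B) := by
  have : growthSet μ α B =
      ⋂ r : ℝ, ⋂ _ : 0 < r, {x | ENNReal.ofReal (B * r ^ α) < μ (Metric.ball x r)}ᶜ := by
    ext x
    simp [growthSet]
  rw [this]
  exact isClosed_iInter fun r => isClosed_iInter fun _ =>
    (isOpen_lt_measure_ball μ _ r).isClosed_compl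

/-- The points where a finite measure has infinite upper `α`-density form a set of zero
`α`-dimensional Hausdorff measure: by Vitali's covering lemma, at each level `n` they are covered
by fivefold enlargements of disjoint balls with `n r ^ α ≤ μ (B(x, r))`. -/
theorem hausdorffMeasure_compl_iUnion_growthSet [BorelSpace X]
    [TopologicalSpace.SeparableSpace X] (μ : Measure X) [IsFiniteMeasure μ] {α : ℝ} (hα : 0 < α) :
    (μH[α] : Measure X) (⋃ n : ℕ, growthSet μ α n)ᶜ = 0 := by
  set bad : Set X := (⋃ n : ℕ, growthSet μ α n)ᶜ with hbad
  set m : ℝ := μ.real Set.univ with hm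
  have hex : ∀ (n : ℕ) (x : X), ∃ r : ℝ, x ∈ bad → 0 < r ∧
      ENNReal.ofReal ((n + 1 : ℝ) * r ^ α) < μ (Metric.ball x r) := by
    intro n x
    by_cases hx : x ∈ bad
    · have h1 : x ∉ growthSet μ α ((n + 1 : ℕ) : ℝ) := fun h =>
        hx (Set.mem_iUnion.2 ⟨n + 1, h⟩)
      simp only [growthSet, Set.mem_ofPred_eq, not_forall, not_le] at h1
      obtain ⟨r, hr, h⟩ := h1
      exact ⟨r, fun _ => ⟨hr, by push_cast at h; exact h⟩⟩
    · exact ⟨0, fun h => absurd h hx⟩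
  choose r hr using hex
  set ρ : ℕ → ℝ := fun n => (m / (n + 1)) ^ (1 / α) with hρ
  have hrρ : ∀ n, ∀ x ∈ bad, r n x ≤ ρ n := by
    intro n x hx
    obtain ⟨h0, h1⟩ := hr n x hx
    have h2 : ENNReal.ofReal ((n + 1 : ℝ) * r n x ^ α) ≤ ENNReal.ofReal m := by
      rw [hm, ofReal_measureReal]
      exact h1.le.trans (measure_mono (Set.subset_univ _))
    have h3 : (n + 1 : ℝ) * r n x ^ α ≤ m :=
      (ENNReal.ofReal_le_ofReal_iff measureReal_nonneg).1 h2
    have h4 : r n x ^ α ≤ m / (n + 1) := by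
      rw [le_div_iff₀ (by positivity)]
      linarith
    calc r n x = (r n x ^ α) ^ (1 / α) := by
          rw [← Real.rpow_mul h0.le, mul_one_div_cancel hα.ne', Real.rpow_one]
      _ ≤ ρ n := Real.rpow_le_rpow (Real.rpow_nonneg h0.le _) h4 (by positivity)
  have hV := fun n : ℕ => Vitali.exists_disjoint_subfamily_covering_enlargement_closedBall
    bad (fun x => x) (r n) (ρ n) (hrρ n) 5 (by norm_num)
  choose u hub hud huc using hV
  have hcount : ∀ n, (u n).Countable := fun n =>
    (hud n).countable_of_nonempty_interior fun x hx =>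
      ⟨x, Metric.ball_subset_interior_closedBall
        (Metric.mem_ball_self (hr n x (hub n hx)).1)⟩
  have := fun n => (hcount n).to_subtype
  have hdiam : ∀ (n : ℕ) (x : X), x ∈ bad →
      Metric.ediam (Metric.closedBall x (5 * r n x)) ≤ ENNReal.ofReal (10 * r n x) := by
    intro n x hx
    have h0 := (hr n x hx).1
    apply Metric.ediam_le
    intro y hy z hz
    rw [edist_dist]
    apply ENNReal.ofReal_le_ofReal
    have := dist_triangle_right y z x
    rw [Metric.mem_closedBall] at hy hz
    linarith
  have hm0 : Filter.Tendsto (fun n : ℕ => m / ((n : ℝ) + 1)) Filter.atTop (nhds 0) := by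
    simpa [div_eq_mul_inv] using
      (tendsto_one_div_add_atTop_nhds_zero_nat (𝕜 := ℝ)).const_mul m
  have hρ0 : Filter.Tendsto (fun n => ENNReal.ofReal (10 * ρ n)) Filter.atTop (nhds 0) := by
    have h := (hm0.rpow_const (p := 1 / α) (Or.inr (by positivity))).const_mul 10
    rw [Real.zero_rpow (by positivity), mul_zero] at h
    have h' := ENNReal.tendsto_ofReal h
    rwa [ENNReal.ofReal_zero] at h'
  have hH := Measure.hausdorffMeasure_le_liminf_tsum (ι := fun n => u n) α bad
    (l := Filter.atTop) (fun n : ℕ => ENNReal.ofReal (10 * ρ n)) hρ0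
    (fun n x => Metric.closedBall (x : X) (5 * r n x))
    (Filter.Eventually.of_forall fun n x => (hdiam n x (hub n x.2)).trans
      (ENNReal.ofReal_le_ofReal (by linarith [hrρ n x (hub n x.2)])))
    (Filter.Eventually.of_forall fun n x hx => by
      obtain ⟨b, hb, hsub⟩ := huc n x hx
      exact Set.mem_iUnion.2 ⟨⟨b, hb⟩,
        hsub (Metric.mem_closedBall_self (hr n x hx).1.le)⟩)
  have hsum : ∀ n : ℕ, ∑' x : u n, Metric.ediam (Metric.closedBall (x : X) (5 * r n x)) ^ α ≤
      ENNReal.ofReal (10 ^ α * (m / (n + 1))) := by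
    intro n
    have hterm : ∀ x : u n, Metric.ediam (Metric.closedBall (x : X) (5 * r n x)) ^ α ≤
        ENNReal.ofReal (10 ^ α / (n + 1)) * μ (Metric.ball (x : X) (r n x)) := by
      intro x
      obtain ⟨h0, h1⟩ := hr n x (hub n x.2)
      have h2 : (10 * r n x) ^ α = 10 ^ α / (n + 1) * ((n + 1) * r n x ^ α) := by
        rw [Real.mul_rpow (by norm_num) h0.le]
        field_simp
      calc _ ≤ ENNReal.ofReal (10 * r n x) ^ α :=
            ENNReal.rpow_le_rpow (hdiam n x (hub n x.2)) hα.le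
        _ = ENNReal.ofReal (10 ^ α / (n + 1)) * ENNReal.ofReal ((n + 1) * r n x ^ α) := by
            rw [ENNReal.ofReal_rpow_of_nonneg (by positivity) hα.le, h2,
              ENNReal.ofReal_mul (by positivity)]
        _ ≤ _ := by gcongr
    calc _ ≤ ∑' x : u n, ENNReal.ofReal (10 ^ α / (n + 1)) * μ (Metric.ball (x : X) (r n x)) :=
          ENNReal.tsum_le_tsum hterm
      _ = ENNReal.ofReal (10 ^ α / (n + 1)) * ∑' x : u n, μ (Metric.ball (x : X) (r n x)) :=
          ENNReal.tsum_mul_left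
      _ ≤ ENNReal.ofReal (10 ^ α / (n + 1)) * μ Set.univ := by
          gcongr
          refine tsum_measure_le_measure_univ
            (fun x => Metric.isOpen_ball.measurableSet.nullMeasurableSet) ?_
          intro x y hxy
          have h := hud n x.2 y.2 (fun h => hxy (Subtype.ext h))
          exact (h.mono Metric.ball_subset_closedBall Metric.ball_subset_closedBall).aedisjoint
      _ = ENNReal.ofReal (10 ^ α * (m / (n + 1))) := by
          rw [← ofReal_measureReal (μ := μ), ← ENNReal.ofReal_mul (by positivity), ← hm]
          congr 1
          ring
  have hlim : Filter.Tendsto (fun n : ℕ => ENNReal.ofReal (10 ^ α * (m / ((n : ℝ) + 1))))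
      Filter.atTop (nhds 0) := by
    simpa using ENNReal.tendsto_ofReal (hm0.const_mul (10 ^ α))
  refine le_antisymm (hH.trans ?_) bot_le
  rw [← hlim.liminf_eq]
  exact Filter.liminf_le_liminf (Filter.Eventually.of_forall hsum)

end Growth

/-- An `α`-continuous finite measure is, up to a set of arbitrarily small measure, uniformly
`α`-Hölder continuous (Rogers and Taylor). -/
theorem IsAlphaContinuous.exists_growthSet {μ : Measure UnitCircle} [IsFiniteMeasure μ] {α : ℝ}
    (hα : 0 ≤ α) (hμ : IsAlphaContinuous α μ) {ε : ℝ≥0∞} (hε : 0 < ε) :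
    ∃ B : ℝ, 0 ≤ B ∧ μ (growthSet μ α B)ᶜ < ε := by
  rcases hα.eq_or_lt with rfl | hα
  · refine ⟨μ.real Set.univ, measureReal_nonneg, ?_⟩
    have : growthSet μ 0 (μ.real Set.univ) = Set.univ := by
      refine Set.eq_univ_of_forall fun x r _ => ?_
      rw [Real.rpow_zero, mul_one, ofReal_measureReal]
      exact measure_mono (Set.subset_univ _)
    simpa [this] using hε
  · have h0 := hμ _ (hausdorffMeasure_compl_iUnion_growthSet μ hα)
    rw [Set.compl_iUnion] at h0
    have hanti : Antitone fun n : ℕ => (growthSet μ α n)ᶜ := fun n k h =>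
      Set.compl_subset_compl.2 (growthSet_mono μ α (by exact_mod_cast h))
    have ht := tendsto_measure_iInter_atTop (μ := μ)
      (fun n : ℕ => (isClosed_growthSet μ α n).measurableSet.compl.nullMeasurableSet)
      hanti ⟨0, measure_ne_top _ _⟩
    rw [h0] at ht
    obtain ⟨n, hn⟩ := (ht.eventually_lt_const hε).exists
    exact ⟨n, n.cast_nonneg, hn⟩

/-! ### Schur's test -/

/-- Schur's test for a finite family `e` of continuous functions: if the kernel
`∑ i, e i z * conj (e i w)` has rows of `L¹(ν)`-norm at most `M`, then `c ↦ ∑ i, c i * e i` is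
bounded from `ℓ²` to `L²(ν)` with norm at most `√M`. -/
theorem integral_norm_sq_sum_le_of_kernel {X ι : Type*} [TopologicalSpace X] [CompactSpace X]
    [SecondCountableTopology X] [MeasurableSpace X] [BorelSpace X] [Fintype ι] (ν : Measure X)
    [IsFiniteMeasure ν] (e : ι → C(X, ℂ)) {M : ℝ} (hM₀ : 0 ≤ M)
    (hM : ∀ᵐ z ∂ν, ∫ w, ‖∑ i, e i z * starRingEnd ℂ (e i w)‖ ∂ν ≤ M) (c : ι → ℂ) :
    ∫ z, ‖∑ i, c i * e i z‖ ^ 2 ∂ν ≤ M * ∑ i, ‖c i‖ ^ 2 := by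
  set p : X → ℂ := fun z => ∑ i, c i * e i z with hp
  have hpc : Continuous p := by fun_prop
  set k : X → X → ℂ := fun z w => ∑ i, e i z * starRingEnd ℂ (e i w) with hk
  have hkc : Continuous fun x : X × X => k x.1 x.2 :=
    continuous_finsetSum _ fun i _ => ((e i).continuous.comp continuous_fst).mul
      (Complex.continuous_conj.comp ((e i).continuous.comp continuous_snd))
  have hksymm : ∀ z w, ‖k z w‖ = ‖k w z‖ := by
    intro z w
    rw [← Complex.norm_conj, hk]
    simp only [map_sum, map_mul, Complex.conj_conj]
    congr 1
    exact Finset.sum_congr rfl fun i _ => mul_comm _ _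
  have hI : ∀ {f : X → ℂ}, Continuous f → Integrable f ν := fun hf =>
    hf.integrable_of_hasCompactSupport (HasCompactSupport.of_compactSpace _)
  have hI1 : ∀ {f : X → ℝ}, Continuous f → Integrable f ν := fun hf =>
    hf.integrable_of_hasCompactSupport (HasCompactSupport.of_compactSpace _)
  have hI2 : ∀ {f : X × X → ℝ}, Continuous f → Integrable f (ν.prod ν) := fun hf =>
    hf.integrable_of_hasCompactSupport (HasCompactSupport.of_compactSpace _)
  have hI3 : ∀ {f : X × X → ℂ}, Continuous f → Integrable f (ν.prod ν) := fun hf =>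
    hf.integrable_of_hasCompactSupport (HasCompactSupport.of_compactSpace _)
  have hconj : Continuous (starRingEnd ℂ) := Complex.continuous_conj
  set P : ℝ := ∫ z, ‖p z‖ ^ 2 ∂ν with hP
  have hP0 : 0 ≤ P := integral_nonneg fun z => by positivity
  set b : ι → ℂ := fun i => ∫ w, p w * starRingEnd ℂ (e i w) ∂ν with hb
  have hPb : (P : ℂ) = ∑ i, starRingEnd ℂ (c i) * b i := by
    calc (P : ℂ) = ∫ z, ((‖p z‖ ^ 2 : ℝ) : ℂ) ∂ν := integral_complex_ofReal.symm
      _ = ∫ z, ∑ i, starRingEnd ℂ (c i) * (p z * starRingEnd ℂ (e i z)) ∂ν := by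
          refine integral_congr_ae (Filter.Eventually.of_forall fun z => ?_)
          simp only []
          rw [Complex.ofReal_pow, ← Complex.mul_conj']
          conv_lhs => rw [hp]
          simp only [map_sum, map_mul, Finset.mul_sum]
          exact Finset.sum_congr rfl fun i _ => by ring
      _ = _ := by
          rw [integral_finsetSum _ fun i _ => hI (by fun_prop)]
          exact Finset.sum_congr rfl fun i _ => integral_const_mul _ _
  -- expanding `∑ ‖b i‖²` as a double integral against the kernel
  have hbk : ((∑ i, ‖b i‖ ^ 2 : ℝ) : ℂ) =
      ∫ x, starRingEnd ℂ (p x.1) * p x.2 * k x.1 x.2 ∂(ν.prod ν) := by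
    have h1 : ∀ i, ((‖b i‖ ^ 2 : ℝ) : ℂ) = ∫ x, (starRingEnd ℂ (p x.1) * e i x.1) *
        (p x.2 * starRingEnd ℂ (e i x.2)) ∂(ν.prod ν) := by
      intro i
      rw [integral_prod_mul (fun z => starRingEnd ℂ (p z) * e i z)
        (fun w => p w * starRingEnd ℂ (e i w)), Complex.ofReal_pow, ← Complex.conj_mul']
      congr 1
      rw [hb, ← integral_conj]
      simp
    rw [Complex.ofReal_sum, Finset.sum_congr rfl fun i _ => h1 i,
      ← integral_finsetSum _ fun i _ => hI3 (by fun_prop)]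
    refine integral_congr_ae (Filter.Eventually.of_forall fun x => ?_)
    simp only [hk, Finset.mul_sum]
    exact Finset.sum_congr rfl fun i _ => by ring
  have hrow : ∫ x, ‖p x.1‖ ^ 2 * ‖k x.1 x.2‖ ∂(ν.prod ν) ≤ M * P := by
    have hrowI : Integrable (fun x : X × X => ‖p x.1‖ ^ 2 * ‖k x.1 x.2‖) (ν.prod ν) :=
      hI2 (by fun_prop)
    rw [integral_prod _ hrowI, hP, ← integral_const_mul]
    refine integral_mono_ae hrowI.integral_prod_left (hI1 (by fun_prop)) ?_
    filter_upwards [hM] with z hz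
    rw [integral_const_mul, mul_comm]
    gcongr
  have hcol : ∫ x, ‖p x.2‖ ^ 2 * ‖k x.1 x.2‖ ∂(ν.prod ν) ≤ M * P := by
    rw [← integral_prod_swap]
    refine le_trans (le_of_eq ?_) hrow
    refine integral_congr_ae (Filter.Eventually.of_forall fun x => ?_)
    simp [hksymm x.2 x.1]
  have hbM : ∑ i, ‖b i‖ ^ 2 ≤ M * P := by
    have h0 : 0 ≤ ∑ i, ‖b i‖ ^ 2 := Finset.sum_nonneg fun i _ => by positivity
    have h1 : ∑ i, ‖b i‖ ^ 2 = ‖((∑ i, ‖b i‖ ^ 2 : ℝ) : ℂ)‖ := by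
      rw [Complex.norm_real, Real.norm_of_nonneg h0]
    rw [h1, hbk]
    calc _ ≤ ∫ x, (1 / 2) * (‖p x.1‖ ^ 2 * ‖k x.1 x.2‖) +
          (1 / 2) * (‖p x.2‖ ^ 2 * ‖k x.1 x.2‖) ∂(ν.prod ν) := by
          refine norm_integral_le_of_norm_le (hI2 (by fun_prop))
            (Filter.Eventually.of_forall fun x => ?_)
          rw [norm_mul, norm_mul, Complex.norm_conj]
          have := mul_nonneg (sq_nonneg (‖p x.1‖ - ‖p x.2‖)) (norm_nonneg (k x.1 x.2))
          nlinarith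
      _ ≤ M * P := by
          rw [integral_add (hI2 (by fun_prop)) (hI2 (by fun_prop)), integral_const_mul,
            integral_const_mul]
          linarith
  have hCS : P ^ 2 ≤ (∑ i, ‖c i‖ ^ 2) * (M * P) := by
    have h1 : P ≤ ∑ i, ‖c i‖ * ‖b i‖ := by
      calc P = ‖(P : ℂ)‖ := by rw [Complex.norm_real, Real.norm_of_nonneg hP0]
        _ ≤ _ := by
          rw [hPb]
          refine (norm_sum_le _ _).trans (le_of_eq ?_)
          simp
    calc P ^ 2 ≤ (∑ i, ‖c i‖ * ‖b i‖) ^ 2 := by gcongr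
      _ ≤ (∑ i, ‖c i‖ ^ 2) * ∑ i, ‖b i‖ ^ 2 := Finset.sum_mul_sq_le_sq_mul_sq _ _ _
      _ ≤ _ := by gcongr
  have hS : 0 ≤ ∑ i, ‖c i‖ ^ 2 := Finset.sum_nonneg fun i _ => by positivity
  rcases hP0.eq_or_lt with h | h
  · rw [← h]; positivity
  · nlinarith

/-! ### The Fejér-type kernel -/

/-- The continuous function `z ↦ z ^ k` on the circle. -/
noncomputable def powFn (k : ℕ) : C(UnitCircle, ℂ) where
  toFun z := (z : ℂ) ^ k
  continuous_toFun := continuous_subtype_val.pow k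

theorem norm_coe_circle (z : UnitCircle) : ‖(z : ℂ)‖ = 1 := by
  simp

theorem norm_powFn (k : ℕ) (z : UnitCircle) : ‖powFn k z‖ = 1 := by
  simp [powFn]

theorem norm_geom_sum_le {ζ : ℂ} (hζ : ‖ζ‖ = 1) (L : ℕ) :
    ‖∑ i ∈ Finset.range L, ζ ^ i‖ ≤ L := by
  refine (norm_sum_le _ _).trans ?_
  simp [hζ]

theorem norm_geom_sum_mul_le {ζ : ℂ} (hζ : ‖ζ‖ = 1) (L : ℕ) :
    ‖∑ i ∈ Finset.range L, ζ ^ i‖ * ‖ζ - 1‖ ≤ 2 := by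
  rw [← norm_mul, geom_sum_mul]
  refine (norm_sub_le _ _).trans ?_
  rw [norm_pow, hζ, norm_one]
  norm_num

/-- The kernel of the family `z ↦ z ^ (i + j)`, `i < K`, `j < 2K`, is a product of two Dirichlet
kernels, so that it decays like the inverse square of the distance. -/
theorem norm_kernel_le (K : ℕ) (z w : UnitCircle) :
    ‖∑ x : Fin K × Fin (2 * K),
      powFn (x.1 + x.2) z * starRingEnd ℂ (powFn (x.1 + x.2) w)‖ ≤ 2 * K ^ 2 ∧
    ‖∑ x : Fin K × Fin (2 * K),
      powFn (x.1 + x.2) z * starRingEnd ℂ (powFn (x.1 + x.2) w)‖ * dist z w ^ 2 ≤ 4 := by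
  set ζ : ℂ := z * starRingEnd ℂ (w : ℂ) with hζ
  have hζ1 : ‖ζ‖ = 1 := by
    rw [hζ, norm_mul, Complex.norm_conj, norm_coe_circle, norm_coe_circle, one_mul]
  have hdist : ‖ζ - 1‖ = dist z w := by
    have h1 : (w : ℂ) * starRingEnd ℂ (w : ℂ) = 1 := by
      rw [Complex.mul_conj', norm_coe_circle]; norm_num
    rw [Subtype.dist_eq, dist_eq_norm, hζ, ← h1, ← sub_mul, norm_mul, Complex.norm_conj,
      norm_coe_circle, mul_one]
  have hk : ∑ x : Fin K × Fin (2 * K),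
      powFn (x.1 + x.2) z * starRingEnd ℂ (powFn (x.1 + x.2) w) =
      (∑ i ∈ Finset.range K, ζ ^ i) * ∑ j ∈ Finset.range (2 * K), ζ ^ j := by
    rw [Finset.sum_range, Finset.sum_range, Finset.sum_mul_sum, Fintype.sum_prod_type]
    refine Finset.sum_congr rfl fun i _ => Finset.sum_congr rfl fun j _ => ?_
    simp only [powFn, ContinuousMap.coe_mk, map_pow, ← mul_pow, ← pow_add, hζ]
  rw [hk, norm_mul, ← hdist]
  constructor
  · calc _ ≤ (K : ℝ) * ((2 * K : ℕ) : ℝ) :=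
          mul_le_mul (norm_geom_sum_le hζ1 _) (norm_geom_sum_le hζ1 _) (norm_nonneg _)
            (by positivity)
      _ = _ := by push_cast; ring
  · calc _ = (‖∑ i ∈ Finset.range K, ζ ^ i‖ * ‖ζ - 1‖) *
          (‖∑ j ∈ Finset.range (2 * K), ζ ^ j‖ * ‖ζ - 1‖) := by ring
      _ ≤ 2 * 2 := mul_le_mul (norm_geom_sum_mul_le hζ1 _) (norm_geom_sum_mul_le hζ1 _)
            (by positivity) (by norm_num)
      _ = 4 := by norm_num

/-- A quantity bounded by `2 K²` and by `4 / r²` is dominated by a sum over the dyadic scales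
`2 ^ j / K` beyond `r`. -/
theorem exists_dyadic_bound {a r K : ℝ} (hK : 0 < K) (h1 : a ≤ 2 * K ^ 2)
    (h2 : a * r ^ 2 ≤ 4) : ∃ j : ℕ, r < 2 ^ j / K ∧ a ≤ 16 * K ^ 2 * (1 / 4) ^ j := by
  have hex : ∃ j : ℕ, r < 2 ^ j / K := by
    obtain ⟨j, hj⟩ := pow_unbounded_of_one_lt (r * K) (by norm_num : (1 : ℝ) < 2)
    exact ⟨j, by rwa [lt_div_iff₀ hK]⟩
  classical
  refine ⟨Nat.find hex, Nat.find_spec hex, ?_⟩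
  rcases hj : Nat.find hex with _ | j
  · rw [pow_zero]; nlinarith
  · have hr : 2 ^ j / K ≤ r := not_lt.1 (Nat.find_min hex (by omega : j < Nat.find hex))
    rcases le_or_gt a 0 with ha | ha
    · exact ha.trans (by positivity)
    have h3 : a * (2 ^ j / K) ^ 2 ≤ 4 := by
      refine le_trans ?_ h2
      gcongr
    have h4 : a * (2 ^ j / K) ^ 2 = a * 4 ^ j / K ^ 2 := by
      rw [div_pow, ← pow_mul, mul_comm j 2, pow_mul]; norm_num; ring
    rw [h4, div_le_iff₀ (by positivity)] at h3
    rw [pow_succ, one_div, inv_pow]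
    calc a = a * 4 ^ j * (4 ^ j)⁻¹ := by field_simp
      _ ≤ 4 * K ^ 2 * (4 ^ j)⁻¹ := by gcongr
      _ = _ := by ring

/-- The row bound for the kernel of `norm_kernel_le` against a measure with `α`-Hölder growth at
`z`, for `α ≤ 1`. -/
theorem integral_norm_kernel_le {ν : Measure UnitCircle} [IsFiniteMeasure ν] {α B : ℝ}
    (hα₁ : α ≤ 1) (hB : 0 ≤ B) {z : UnitCircle}
    (hz : z ∈ growthSet ν α B) {K : ℕ} (hK : 1 ≤ K) :
    ∫ w, ‖∑ x : Fin K × Fin (2 * K),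
      powFn (x.1 + x.2) z * starRingEnd ℂ (powFn (x.1 + x.2) w)‖ ∂ν ≤
      32 * B * (K : ℝ) ^ (2 - α) := by
  have hK0 : (0 : ℝ) < K := by exact_mod_cast hK
  set k : UnitCircle → ℂ := fun w => ∑ x : Fin K × Fin (2 * K),
      powFn (x.1 + x.2) z * starRingEnd ℂ (powFn (x.1 + x.2) w) with hk
  have hkc : Continuous k :=
    continuous_finsetSum _ fun i _ => continuous_const.mul
      (Complex.continuous_conj.comp (powFn _).continuous)
  have hpt : ∀ w, ENNReal.ofReal ‖k w‖ ≤ ∑' j : ℕ, (Metric.ball z (2 ^ j / K)).indicator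
      (fun _ => ENNReal.ofReal (16 * (K : ℝ) ^ 2 * (1 / 4) ^ j)) w := by
    intro w
    obtain ⟨j, hj, hj'⟩ := exists_dyadic_bound hK0 (norm_kernel_le K z w).1
      (norm_kernel_le K z w).2
    refine le_trans ?_ (ENNReal.le_tsum j)
    rw [Set.indicator_of_mem (by rwa [Metric.mem_ball, dist_comm])]
    exact ENNReal.ofReal_le_ofReal hj'
  rw [integral_eq_lintegral_of_nonneg_ae (Filter.Eventually.of_forall fun w => norm_nonneg _)
    hkc.norm.aestronglyMeasurable]
  refine ENNReal.toReal_le_of_le_ofReal (by positivity) ?_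
  calc ∫⁻ w, ENNReal.ofReal ‖k w‖ ∂ν ≤ ∫⁻ w, ∑' j : ℕ, (Metric.ball z (2 ^ j / K)).indicator
        (fun _ => ENNReal.ofReal (16 * (K : ℝ) ^ 2 * (1 / 4) ^ j)) w ∂ν := lintegral_mono hpt
    _ = ∑' j : ℕ, ENNReal.ofReal (16 * (K : ℝ) ^ 2 * (1 / 4) ^ j) *
          ν (Metric.ball z (2 ^ j / K)) := by
        rw [lintegral_tsum fun j =>
          (measurable_const.indicator Metric.isOpen_ball.measurableSet).aemeasurable]
        exact tsum_congr fun j => lintegral_indicator_const Metric.isOpen_ball.measurableSet _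
    _ ≤ ∑' j : ℕ, ENNReal.ofReal (16 * B * (K : ℝ) ^ (2 - α) * (1 / 2) ^ j) := by
        refine ENNReal.tsum_le_tsum fun j => ?_
        refine (mul_le_mul_right (hz (2 ^ j / K) (by positivity)) _).trans ?_
        rw [← ENNReal.ofReal_mul (by positivity)]
        apply ENNReal.ofReal_le_ofReal
        have h1 : ((2 : ℝ) ^ j / K) ^ α ≤ 2 ^ j * ((K : ℝ) ^ α)⁻¹ := by
          rw [Real.div_rpow (by positivity) hK0.le, div_eq_mul_inv]
          gcongr
          conv_rhs => rw [← Real.rpow_one ((2 : ℝ) ^ j)]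
          exact Real.rpow_le_rpow_of_exponent_le (one_le_pow₀ (by norm_num)) hα₁
        have h2 : (K : ℝ) ^ (2 - α) = (K : ℝ) ^ 2 * ((K : ℝ) ^ α)⁻¹ := by
          rw [Real.rpow_sub hK0, div_eq_mul_inv]
          norm_num
        have h3 : ((1 : ℝ) / 4) ^ j = (1 / 2) ^ j * (2 ^ j)⁻¹ := by
          rw [← inv_pow, ← mul_pow]; norm_num
        calc 16 * (K : ℝ) ^ 2 * (1 / 4) ^ j * (B * (2 ^ j / K) ^ α)
            ≤ 16 * (K : ℝ) ^ 2 * (1 / 4) ^ j * (B * (2 ^ j * ((K : ℝ) ^ α)⁻¹)) := by gcongr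
          _ = _ := by
            rw [h2, h3]
            field_simp
    _ = ENNReal.ofReal (32 * B * (K : ℝ) ^ (2 - α)) := by
        rw [← ENNReal.ofReal_tsum_of_nonneg (fun j => by positivity)
          (summable_geometric_two.mul_left _), tsum_mul_left, tsum_geometric_two]
        congr 1
        ring

/-! ### Analysis and synthesis in inner product spaces -/

section InnerProductSpace

variable {H : Type*} [NormedAddCommGroup H] [InnerProductSpace ℂ H]

/-- Bessel-type duality: an upper bound for the synthesis operator `c ↦ ∑ i, c i • x i` bounds the
analysis operator `φ ↦ (⟨φ, x i⟩)ᵢ`. -/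
theorem sum_norm_inner_sq_le {ι : Type*} [Fintype ι] (x : ι → H) {M : ℝ} (hM₀ : 0 ≤ M)
    (hM : ∀ c : ι → ℂ, ‖∑ i, c i • x i‖ ^ 2 ≤ M * ∑ i, ‖c i‖ ^ 2) (φ : H) :
    ∑ i, ‖inner ℂ φ (x i)‖ ^ 2 ≤ M * ‖φ‖ ^ 2 := by
  set S := ∑ i, ‖inner ℂ φ (x i)‖ ^ 2 with hS
  have hS0 : 0 ≤ S := Finset.sum_nonneg fun i _ => by positivity
  set v := ∑ i, starRingEnd ℂ (inner ℂ φ (x i)) • x i with hv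
  have h1 : inner ℂ φ v = (S : ℂ) := by
    rw [hv, inner_sum, hS, Complex.ofReal_sum]
    refine Finset.sum_congr rfl fun i _ => ?_
    rw [inner_smul_right, Complex.conj_mul', Complex.ofReal_pow]
  have h2 : S ≤ ‖φ‖ * ‖v‖ := by
    have h := norm_inner_le_norm (𝕜 := ℂ) φ v
    rwa [h1, Complex.norm_real, Real.norm_of_nonneg hS0] at h
  have h3 : ‖v‖ ^ 2 ≤ M * S := by
    refine (hM _).trans (le_of_eq ?_)
    simp only [hS, Complex.norm_conj]
  have h4 : S ^ 2 ≤ ‖φ‖ ^ 2 * (M * S) := by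
    calc S ^ 2 ≤ (‖φ‖ * ‖v‖) ^ 2 := by gcongr
      _ = ‖φ‖ ^ 2 * ‖v‖ ^ 2 := by ring
      _ ≤ _ := by gcongr
  rcases hS0.eq_or_lt with h | h
  · rw [← h]; positivity
  · nlinarith

theorem hasSum_norm_inner_sq {ι : Type*} (φ : HilbertBasis ι ℂ H) (x : H) :
    HasSum (fun n => ‖inner ℂ (φ n) x‖ ^ 2) (‖x‖ ^ 2) := by
  have h := φ.hasSum_inner_mul_inner x x
  have h1 : ∀ n, inner ℂ x (φ n) * inner ℂ (φ n) x = ((‖inner ℂ (φ n) x‖ ^ 2 : ℝ) : ℂ) := by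
    intro n
    rw [← inner_conj_symm, Complex.conj_mul', Complex.ofReal_pow]
  rw [inner_self_eq_norm_sq_to_K] at h
  simp only [h1] at h
  have h2 : ((‖x‖ : ℝ) : ℂ) ^ 2 = ((‖x‖ ^ 2 : ℝ) : ℂ) := by push_cast; rfl
  exact Complex.hasSum_ofReal.1 (h2 ▸ h)

end InnerProductSpace

/-! ### Transition probabilities of a unitary operator -/

section Operator

variable {H : Type*} [NormedAddCommGroup H] [InnerProductSpace ℂ H] [CompleteSpace H]

theorem functionOf_powFn (U : unitary (H →L[ℂ] H)) (k : ℕ) :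
    functionOf U (powFn k) = (U : H →L[ℂ] H) ^ k := by
  have h1 : functionOf U (powFn 1) = (U : H →L[ℂ] H) := by
    have h := cfcHom_id (R := ℂ) (Unitary.coe_isStarNormal U)
    conv_rhs => rw [← h]
    change cfcHom (R := ℂ) (Unitary.coe_isStarNormal U) _ = _
    congr 1
    ext z
    simp [powFn, spectrumToCircle]
  have h2 : powFn k = powFn 1 ^ k := by
    ext z
    simp [powFn]
  rw [h2, map_pow, h1]

theorem norm_functionOf_sq (U : unitary (H →L[ℂ] H)) (ψ : H) (g : C(UnitCircle, ℂ)) :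
    ‖functionOf U g ψ‖ ^ 2 = ∫ z, ‖g z‖ ^ 2 ∂(spectralMeasure U ψ) := by
  have h := inner_functionOf_eq_integral U ψ (star g * g)
  rw [map_mul, map_star, ContinuousLinearMap.star_eq_adjoint, mul_apply_eq_comp,
    ContinuousLinearMap.adjoint_inner_right, inner_self_eq_norm_sq_to_K] at h
  have h' : ∀ z, (star g * g) z = ((‖g z‖ ^ 2 : ℝ) : ℂ) := by
    intro z
    simp only [ContinuousMap.mul_apply, ContinuousMap.star_apply, Complex.star_def,
      Complex.conj_mul', Complex.ofReal_pow]
  rw [integral_congr_ae (Filter.Eventually.of_forall h'), integral_complex_ofReal] at h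
  exact Complex.ofReal_injective (by simpa using h)

theorem inner_pow_map_map (U : unitary (H →L[ℂ] H)) (k : ℕ) (x y : H) :
    inner ℂ (((U : H →L[ℂ] H) ^ k) x) (((U : H →L[ℂ] H) ^ k) y) = inner ℂ x y :=
  ContinuousLinearMap.inner_map_map_of_mem_unitary (pow_mem U.2 k) x y

theorem norm_pow_map (U : unitary (H →L[ℂ] H)) (k : ℕ) (x : H) :
    ‖((U : H →L[ℂ] H) ^ k) x‖ = ‖x‖ :=
  ContinuousLinearMap.norm_map_of_mem_unitary (pow_mem U.2 k) x

/-- Every window `[i, i + 2K)` with `i < K` contains `[K, 2K)`. -/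
theorem mul_sum_shift_le {b : ℕ → ℝ} (hb : ∀ m, 0 ≤ b m) (K : ℕ) :
    K * ∑ k ∈ Finset.range K, b (K + k) ≤ ∑ x : Fin K × Fin (2 * K), b (x.1 + x.2) := by
  rw [Fintype.sum_prod_type]
  have h : ∀ i : Fin K, ∑ k ∈ Finset.range K, b (K + k) ≤ ∑ j : Fin (2 * K), b (i + j) := by
    intro i
    rw [← Finset.sum_range fun j => b (i + j)]
    have h1 : ∀ n : ℕ, ∑ j ∈ Finset.range (2 * K), b (n + j) =
        ∑ m ∈ Finset.Ico n (n + 2 * K), b m := by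
      intro n
      rw [Finset.sum_Ico_eq_sum_range, Nat.add_sub_cancel_left]
    have h2 : ∑ k ∈ Finset.range K, b (K + k) = ∑ m ∈ Finset.Ico K (2 * K), b m := by
      rw [Finset.sum_Ico_eq_sum_range]
      congr 2
      omega
    rw [h1, h2]
    refine Finset.sum_le_sum_of_subset_of_nonneg (fun m hm => ?_) fun m _ _ => hb m
    have := i.2
    rw [Finset.mem_Ico] at hm ⊢
    omega
  refine le_trans (le_of_eq ?_) (Finset.sum_le_sum fun i _ => h i)
  simp

/-- For each time horizon `K`, a vector within `μ_ψ(Eᶜ)^(1/2)` of `ψ`, with `E` the set where `μ_ψ`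
has `α`-Hölder growth, has transition probabilities of order `K ^ (-α)` on average. The vector stands
for `χ_E(U) ψ`; it is `g(U) ψ` with a continuous `g` that approximates the indicator function of
`E` to an accuracy that depends on `K`, while the bounds do not. -/
theorem exists_near_sum_norm_inner_sq_le (U : unitary (H →L[ℂ] H)) (ψ : H) {α B : ℝ}
    (hα₁ : α ≤ 1) (hB : 0 ≤ B) {K : ℕ} (hK : 1 ≤ K) :
    ∃ ψ₁ : H, ‖ψ - ψ₁‖ ^ 2 ≤
        (spectralMeasure U ψ).real (growthSet (spectralMeasure U ψ) α B)ᶜ ∧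
      ∀ φ : H, ∑ k ∈ Finset.range K, ‖inner ℂ φ (((U : H →L[ℂ] H) ^ k) ψ₁)‖ ^ 2 ≤
        (32 * B + 1) * (K : ℝ) ^ (1 - α) * ‖φ‖ ^ 2 := by
  set μ := spectralMeasure U ψ with hμ
  set E := growthSet μ α B with hE
  have hEc : IsClosed E := isClosed_growthSet μ α B
  have hK1 : (1 : ℝ) ≤ K := by exact_mod_cast hK
  have hK0 : (0 : ℝ) < K := by linarith
  obtain ⟨O, hEO, hO, hμO⟩ := E.exists_isOpen_lt_add (μ := μ) (measure_ne_top _ _)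
    (ε := ENNReal.ofReal (1 / (2 * K ^ 2))) (by positivity)
  have hOE : μ.real (O \ E) ≤ 1 / (2 * (K : ℝ) ^ 2) := by
    refine ENNReal.toReal_le_of_le_ofReal (by positivity) ?_
    rw [measure_sdiff hEO hEc.measurableSet.nullMeasurableSet (measure_ne_top _ _)]
    exact tsub_le_iff_left.2 hμO.le
  obtain ⟨h, h0, h1, h01⟩ := exists_continuous_zero_one_of_isClosed hO.isClosed_compl hEc
    (Set.disjoint_compl_left_iff_subset.2 hEO)
  let g : C(UnitCircle, ℂ) := ⟨fun z => (h z : ℂ), Complex.continuous_ofReal.comp h.continuous⟩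
  have hg : ∀ z, ‖g z‖ = h z := fun z => by
    simp only [g, ContinuousMap.coe_mk, Complex.norm_real]
    exact Real.norm_of_nonneg (h01 z).1
  have hI : ∀ {f : UnitCircle → ℝ}, Continuous f → Integrable f μ := fun hf =>
    hf.integrable_of_hasCompactSupport (HasCompactSupport.of_compactSpace _)
  refine ⟨functionOf U g ψ, ?_, ?_⟩
  · have hsub : ψ - functionOf U g ψ = functionOf U (1 - g) ψ := by
      rw [map_sub, map_one, sub_apply, one_apply_eq_self]
    rw [hsub, norm_functionOf_sq, ← hμ, ← integral_indicator_one hEc.measurableSet.compl]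
    refine integral_mono (hI (by fun_prop))
      ((integrable_const 1).indicator hEc.measurableSet.compl) fun z => ?_
    have hz : (1 - g) z = ((1 - h z : ℝ) : ℂ) := by simp [g]
    simp only [hz, Complex.norm_real, Real.norm_eq_abs, sq_abs]
    by_cases hzE : z ∈ E
    · rw [h1 hzE]; simp [hzE]
    · rw [Set.indicator_of_mem hzE, Pi.one_apply]
      have := h01 z
      nlinarith [this.1, this.2]
  · have hsyn : ∀ c : Fin K × Fin (2 * K) → ℂ,
        ‖∑ x, c x • ((U : H →L[ℂ] H) ^ (x.1 + x.2 : ℕ)) (functionOf U g ψ)‖ ^ 2 ≤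
          (32 * B + 1) * (K : ℝ) ^ (2 - α) * ∑ x, ‖c x‖ ^ 2 := by
      intro c
      set S := ∑ x, ‖c x‖ ^ 2 with hS
      have hS0 : 0 ≤ S := Finset.sum_nonneg fun i _ => by positivity
      have hv : ∑ x, c x • ((U : H →L[ℂ] H) ^ (x.1 + x.2 : ℕ)) (functionOf U g ψ) =
          functionOf U (∑ x, c x • (powFn (x.1 + x.2) * g)) ψ := by
        rw [map_sum, sum_apply]
        refine Finset.sum_congr rfl fun x _ => ?_
        rw [map_smul, map_mul, functionOf_powFn]
        rfl
      set p : UnitCircle → ℂ := fun z => ∑ x, c x * powFn (x.1 + x.2) z with hp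
      have hpc : Continuous p := by fun_prop
      have hnorm : ∀ z, ‖(∑ x, c x • (powFn (x.1 + x.2) * g) : C(UnitCircle, ℂ)) z‖ ^ 2 =
          ‖p z‖ ^ 2 * h z ^ 2 := by
        intro z
        rw [← hg, ← mul_pow, ← norm_mul, hp, Finset.sum_mul]
        simp [ContinuousMap.sum_apply, mul_assoc]
      have hpS : ∀ z, ‖p z‖ ^ 2 ≤ 2 * (K : ℝ) ^ 2 * S := by
        intro z
        calc ‖p z‖ ^ 2 ≤ (∑ x, ‖c x‖) ^ 2 := by
              gcongr
              refine (norm_sum_le _ _).trans (le_of_eq ?_)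
              simp [norm_powFn]
          _ ≤ _ := sq_sum_le_card_mul_sum_sq
          _ = _ := by
              rw [Finset.card_univ, Fintype.card_prod, Fintype.card_fin, Fintype.card_fin]
              push_cast
              ring
      have hgrow : ∀ᵐ z ∂(μ.restrict E), z ∈ growthSet (μ.restrict E) α B := by
        filter_upwards [ae_restrict_mem hEc.measurableSet] with z hz r hr
        exact (Measure.restrict_apply_le _ _).trans (hz r hr)
      have hschur := integral_norm_sq_sum_le_of_kernel (μ.restrict E)
        (fun x : Fin K × Fin (2 * K) => powFn (x.1 + x.2))
        (M := 32 * B * (K : ℝ) ^ (2 - α)) (by positivity)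
        (hgrow.mono fun z hz => integral_norm_kernel_le hα₁ hB hz hK) c
      have hKα : 1 ≤ (K : ℝ) ^ (2 - α) := Real.one_le_rpow hK1 (by linarith)
      rw [hv, norm_functionOf_sq, ← hμ]
      calc ∫ z, ‖(∑ x, c x • (powFn (x.1 + x.2) * g) : C(UnitCircle, ℂ)) z‖ ^ 2 ∂μ
          ≤ ∫ z, E.indicator (fun z => ‖p z‖ ^ 2) z +
              (O \ E).indicator (fun _ => 2 * (K : ℝ) ^ 2 * S) z ∂μ := by
            refine integral_mono (hI (by fun_prop))
              (((hI (by fun_prop)).indicator hEc.measurableSet).add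
                ((integrable_const _).indicator (hO.measurableSet.diff hEc.measurableSet)))
              fun z => ?_
            simp only [hnorm]
            by_cases hzE : z ∈ E
            · rw [h1 hzE]; simp [hzE]
            by_cases hzO : z ∈ O
            · rw [Set.indicator_of_notMem hzE, Set.indicator_of_mem (show z ∈ O \ E from ⟨hzO, hzE⟩), zero_add]
              refine le_trans ?_ (hpS z)
              have := h01 z
              exact mul_le_of_le_one_right (by positivity) (pow_le_one₀ this.1 this.2)
            · rw [h0 hzO]; simp [hzE, hzO]
        _ = ∫ z, ‖p z‖ ^ 2 ∂(μ.restrict E) + μ.real (O \ E) * (2 * (K : ℝ) ^ 2 * S) := by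
            rw [integral_add ((hI (by fun_prop)).indicator hEc.measurableSet)
                ((integrable_const _).indicator (hO.measurableSet.diff hEc.measurableSet)),
              integral_indicator hEc.measurableSet,
              integral_indicator_const _ (hO.measurableSet.diff hEc.measurableSet), smul_eq_mul]
        _ ≤ 32 * B * (K : ℝ) ^ (2 - α) * S +
              1 / (2 * (K : ℝ) ^ 2) * (2 * (K : ℝ) ^ 2 * S) := by gcongr
        _ = 32 * B * (K : ℝ) ^ (2 - α) * S + 1 * S := by field_simp
        _ ≤ 32 * B * (K : ℝ) ^ (2 - α) * S + (K : ℝ) ^ (2 - α) * S := by gcongr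
        _ = _ := by ring
    intro φ
    have hana := sum_norm_inner_sq_le _ (by positivity) hsyn (((U : H →L[ℂ] H) ^ K) φ)
    rw [norm_pow_map] at hana
    have hshift := mul_sum_shift_le (b := fun m => ‖inner ℂ (((U : H →L[ℂ] H) ^ K) φ)
      (((U : H →L[ℂ] H) ^ m) (functionOf U g ψ))‖ ^ 2) (fun m => by positivity) K
    have hinner : ∀ k, inner ℂ (((U : H →L[ℂ] H) ^ K) φ)
        (((U : H →L[ℂ] H) ^ (K + k)) (functionOf U g ψ)) =
        inner ℂ φ (((U : H →L[ℂ] H) ^ k) (functionOf U g ψ)) := fun k => by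
      rw [pow_add, mul_apply_eq_comp, inner_pow_map_map]
    simp only [hinner] at hshift
    refine le_of_mul_le_mul_left ((hshift.trans hana).trans (le_of_eq ?_)) hK0
    rw [show (2 - α : ℝ) = 1 + (1 - α) by ring, Real.rpow_add hK0, Real.rpow_one]
    ring

end Operator

/-! ### Moments -/

section Moments

variable {H : Type*} [NormedAddCommGroup H] [InnerProductSpace ℂ H] [CompleteSpace H]
  {d : ℕ} {A : Set (Fin d → ℤ)}

theorem stateProbability_nonneg (U : unitary (H →L[ℂ] H)) (φ : HilbertBasis A ℂ H) (ψ : H)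
    (n : A) (k : ℕ) : 0 ≤ stateProbability U φ ψ n k := by
  unfold stateProbability
  positivity

theorem hasSum_stateProbability (U : unitary (H →L[ℂ] H)) (φ : HilbertBasis A ℂ H) (ψ : H)
    (k : ℕ) : HasSum (fun n => stateProbability U φ ψ n k) (‖ψ‖ ^ 2) := by
  have h := hasSum_norm_inner_sq φ (((U : H →L[ℂ] H) ^ k) ψ)
  rwa [norm_pow_map] at h

theorem latticeNorm_nonneg (n : Fin d → ℤ) : 0 ≤ latticeNorm n :=
  Finset.sum_nonneg fun _ _ => abs_nonneg _

/-- At most `(3R) ^ d` lattice points have norm below `R ≥ 1`. -/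
theorem exists_finset_latticeNorm (A : Set (Fin d → ℤ)) {R : ℝ} (hR : 1 ≤ R) :
    ∃ F : Finset A, (F.card : ℝ) ≤ (3 * R) ^ d ∧
      ∀ n : A, n ∉ F → R ≤ latticeNorm (n : Fin d → ℤ) := by
  classical
  set N : ℕ := ⌊R⌋₊ with hN
  have hNR : (N : ℝ) ≤ R := Nat.floor_le (by linarith)
  let box : Finset (Fin d → ℤ) := Fintype.piFinset fun _ => Finset.Icc (-(N : ℤ)) N
  refine ⟨box.subtype (· ∈ A), ?_, fun n hn => ?_⟩
  · have h1 : box.card = (2 * N + 1) ^ d := by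
      simp only [box, Fintype.card_piFinset_const, Int.card_Icc]
      congr 1
      omega
    calc ((box.subtype (· ∈ A)).card : ℝ) ≤ box.card := by
          rw [Finset.card_subtype]
          exact_mod_cast Finset.card_filter_le _ _
      _ = (2 * N + 1 : ℝ) ^ d := by rw [h1]; push_cast; rfl
      _ ≤ (3 * R) ^ d := by gcongr; linarith
  · by_contra! hlt
    refine hn (Finset.mem_subtype.2 (Fintype.mem_piFinset.2 fun i => ?_))
    have h1 : |((n : Fin d → ℤ) i : ℝ)| ≤ latticeNorm (n : Fin d → ℤ) :=
      Finset.single_le_sum (f := fun i => |((n : Fin d → ℤ) i : ℝ)|)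
        (fun _ _ => abs_nonneg _) (Finset.mem_univ i)
    have h2 : (((n : Fin d → ℤ) i).natAbs : ℝ) ≤ R := by
      rw [Nat.cast_natAbs, Int.cast_abs]
      linarith
    have h3 : ((n : Fin d → ℤ) i).natAbs ≤ N := Nat.le_floor h2
    rw [Finset.mem_Icc]
    omega

theorem one_le_moment (U : unitary (H →L[ℂ] H)) (φ : HilbertBasis A ℂ H) {ψ : H} (hψ : ‖ψ‖ = 1)
    (p : ℝ) (k : ℕ) : 1 ≤ moment U φ ψ p k := by
  have h := hasSum_stateProbability U φ ψ k
  rw [hψ, one_pow] at h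
  calc (1 : ℝ≥0∞) = ENNReal.ofReal (∑' n, stateProbability U φ ψ n k) := by simp [h.tsum_eq]
    _ = ∑' n, ENNReal.ofReal (stateProbability U φ ψ n k) :=
        ENNReal.ofReal_tsum_of_nonneg (fun n => stateProbability_nonneg U φ ψ n k) h.summable
    _ ≤ _ := by
        refine ENNReal.tsum_le_tsum fun n => ENNReal.ofReal_le_ofReal ?_
        have h1 := Real.rpow_nonneg (latticeNorm_nonneg (n : Fin d → ℤ)) p
        have h2 := stateProbability_nonneg U φ ψ n k
        nlinarith

/-- Chebyshev's inequality for the position distribution at time `k`. -/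
theorem le_moment_of_finset (U : unitary (H →L[ℂ] H)) (φ : HilbertBasis A ℂ H) {ψ : H}
    (hψ : ‖ψ‖ = 1) {p R : ℝ} (hp : 0 < p) (hR : 0 ≤ R) {F : Finset A}
    (hF : ∀ n : A, n ∉ F → R ≤ latticeNorm (n : Fin d → ℤ)) (k : ℕ) :
    ENNReal.ofReal (R ^ p * (1 - ∑ n ∈ F, stateProbability U φ ψ n k)) ≤ moment U φ ψ p k := by
  classical
  have h := hasSum_stateProbability U φ ψ k
  rw [hψ, one_pow] at h
  have hR0 := Real.rpow_nonneg hR p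
  set f : A → ℝ := fun n => if n ∈ F then 0 else stateProbability U φ ψ n k with hf
  have hfs : HasSum f (1 - ∑ n ∈ F, stateProbability U φ ψ n k) := by
    have h1 : HasSum (fun n => if n ∈ F then stateProbability U φ ψ n k else 0)
        (∑ n ∈ F, if n ∈ F then stateProbability U φ ψ n k else 0) :=
      hasSum_sum_of_ne_finset_zero fun n hn => if_neg hn
    rw [Finset.sum_congr rfl fun n hn => if_pos hn] at h1
    have hfe : f = fun n => stateProbability U φ ψ n k -
        if n ∈ F then stateProbability U φ ψ n k else 0 := by
      funext n
      simp only [hf]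
      split_ifs <;> ring
    rw [hfe]
    exact h.sub h1
  have hf0 : ∀ n, 0 ≤ f n := fun n => by
    simp only [hf]
    split_ifs
    · exact le_rfl
    · exact stateProbability_nonneg U φ ψ n k
  rw [← hfs.tsum_eq, ← tsum_mul_left,
    ENNReal.ofReal_tsum_of_nonneg (fun n => mul_nonneg hR0 (hf0 n)) (hfs.summable.mul_left _)]
  refine ENNReal.tsum_le_tsum fun n => ENNReal.ofReal_le_ofReal ?_
  have h1 := Real.rpow_nonneg (latticeNorm_nonneg (n : Fin d → ℤ)) p
  have h2 := stateProbability_nonneg U φ ψ n k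
  simp only [hf]
  split_ifs with hn
  · rw [mul_zero]; positivity
  · have h3 := Real.rpow_le_rpow hR (hF n hn) hp.le
    gcongr
    linarith

theorem le_cesaroAverage {f : ℕ → ℝ≥0∞} {g : ℕ → ℝ} {K : ℕ} (hK : 1 ≤ K)
    (h : ∀ k, ENNReal.ofReal (g k) ≤ f k) :
    ENNReal.ofReal ((∑ k ∈ Finset.range K, g k) / K) ≤ cesaroAverage f K := by
  have hK0 : (0 : ℝ) < K := by exact_mod_cast hK
  unfold cesaroAverage
  rw [ENNReal.ofReal_div_of_pos hK0, ENNReal.ofReal_natCast]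
  gcongr
  refine le_trans ?_ (Finset.sum_le_sum fun k _ => h k)
  induction Finset.range K using Finset.cons_induction with
  | empty => simp
  | cons a s ha ih =>
    rw [Finset.sum_cons, Finset.sum_cons]
    exact ENNReal.ofReal_add_le.trans (by gcongr)

/-- The time-averaged probability of finding the state in a finite set `F` of sites, for a vector
`ψ` close to a vector `ψ₁` with small transition probabilities. -/
theorem sum_stateProbability_le (U : unitary (H →L[ℂ] H)) (φ : HilbertBasis A ℂ H) (ψ ψ₁ : H)
    {K : ℕ} {Q t : ℝ} (ht : 0 < t)
    (hQ : ∀ χ : H, ∑ k ∈ Finset.range K, ‖inner ℂ χ (((U : H →L[ℂ] H) ^ k) ψ₁)‖ ^ 2 ≤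
      Q * ‖χ‖ ^ 2) (F : Finset A) :
    ∑ k ∈ Finset.range K, ∑ n ∈ F, stateProbability U φ ψ n k ≤
      (1 + t) * (K * ‖ψ - ψ₁‖ ^ 2) + (1 + 1 / t) * (F.card * Q) := by
  have hpt : ∀ k n, stateProbability U φ ψ n k ≤ (1 + t) * stateProbability U φ (ψ - ψ₁) n k +
      (1 + 1 / t) * stateProbability U φ ψ₁ n k := by
    intro k n
    unfold stateProbability
    set x : ℂ := inner ℂ (φ n) (((U : H →L[ℂ] H) ^ k) (ψ - ψ₁))
    set y : ℂ := inner ℂ (φ n) (((U : H →L[ℂ] H) ^ k) ψ₁)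
    have hxy : inner ℂ (φ n) (((U : H →L[ℂ] H) ^ k) ψ) = x + y := by
      rw [← inner_add_right, ← map_add, sub_add_cancel]
    rw [hxy]
    have h1 : ‖x + y‖ ^ 2 ≤ (‖x‖ + ‖y‖) ^ 2 := by gcongr; exact norm_add_le x y
    have h2 : (1 + t) * ‖x‖ ^ 2 + (1 + 1 / t) * ‖y‖ ^ 2 - (‖x‖ + ‖y‖) ^ 2 =
        (t * ‖x‖ - ‖y‖) ^ 2 / t := by
      field_simp
      ring
    have h3 : 0 ≤ (t * ‖x‖ - ‖y‖) ^ 2 / t := by positivity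
    linarith
  have h1 : ∑ k ∈ Finset.range K, ∑ n ∈ F, stateProbability U φ (ψ - ψ₁) n k ≤
      K * ‖ψ - ψ₁‖ ^ 2 := by
    calc _ ≤ ∑ k ∈ Finset.range K, ‖ψ - ψ₁‖ ^ 2 := Finset.sum_le_sum fun k _ =>
          sum_le_hasSum F (fun n _ => stateProbability_nonneg U φ _ n k)
            (hasSum_stateProbability U φ _ k)
      _ = _ := by simp
  have h2 : ∑ k ∈ Finset.range K, ∑ n ∈ F, stateProbability U φ ψ₁ n k ≤ F.card * Q := by
    rw [Finset.sum_comm]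
    calc _ ≤ ∑ n ∈ F, Q := Finset.sum_le_sum fun n _ => by
          simpa [stateProbability, φ.orthonormal.1 n] using hQ (φ n)
      _ = _ := by simp
  calc _ ≤ ∑ k ∈ Finset.range K, ∑ n ∈ F, ((1 + t) * stateProbability U φ (ψ - ψ₁) n k +
        (1 + 1 / t) * stateProbability U φ ψ₁ n k) :=
        Finset.sum_le_sum fun k _ => Finset.sum_le_sum fun n _ => hpt k n
    _ = (1 + t) * ∑ k ∈ Finset.range K, ∑ n ∈ F, stateProbability U φ (ψ - ψ₁) n k +
        (1 + 1 / t) * ∑ k ∈ Finset.range K, ∑ n ∈ F, stateProbability U φ ψ₁ n k := by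
        simp only [Finset.sum_add_distrib, Finset.mul_sum]
    _ ≤ _ := by gcongr

/-- A vector with a nonzero `α`-continuous component is, for each time horizon `K`, at distance at
most `r < 1` from a vector whose transition probabilities are of order `K ^ (-α)` on average, with `r`
and the constant independent of `K`. -/
theorem exists_uniform_approx (U : unitary (H →L[ℂ] H)) {ψ : H} (hψ : ‖ψ‖ = 1) {α : ℝ}
    (hα₀ : 0 ≤ α) (hα₁ : α ≤ 1) (hP : alphaContinuousProjection U α ψ ≠ 0) :
    ∃ r Q : ℝ, 0 ≤ r ∧ r < 1 ∧ 0 < Q ∧ ∀ K : ℕ, 1 ≤ K → ∃ ψ₁ : H, ‖ψ - ψ₁‖ ≤ r ∧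
      ∀ χ : H, ∑ k ∈ Finset.range K, ‖inner ℂ χ (((U : H →L[ℂ] H) ^ k) ψ₁)‖ ^ 2 ≤
        Q * (K : ℝ) ^ (1 - α) * ‖χ‖ ^ 2 := by
  set ψc : H := alphaContinuousProjection U α ψ with hψc
  have hmem : IsAlphaContinuous α (spectralMeasure U ψc) :=
    (alphaContinuousSubspace U α).starProjection_apply_mem ψ
  have hdist : ‖ψ - ψc‖ < 1 := by
    have h := (alphaContinuousSubspace U α).norm_sq_eq_add_norm_sq_starProjection ψ
    rw [Submodule.starProjection_orthogonal_val] at h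
    change ‖ψ‖ ^ 2 = ‖ψc‖ ^ 2 + ‖ψ - ψc‖ ^ 2 at h
    rw [hψ] at h
    have := norm_pos_iff.2 hP
    have := norm_nonneg (ψ - ψc)
    nlinarith
  set η : ℝ := (1 - ‖ψ - ψc‖) / 2 with hη
  have hη0 : 0 < η := by rw [hη]; linarith
  obtain ⟨B, hB, hμ⟩ := hmem.exists_growthSet hα₀ (ε := ENNReal.ofReal (η ^ 2)) (by positivity)
  refine ⟨‖ψ - ψc‖ + η, 32 * B + 1, by positivity, by linarith, by positivity, fun K hK => ?_⟩
  obtain ⟨ψ₁, h1, h2⟩ := exists_near_sum_norm_inner_sq_le U ψc hα₁ hB hK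
  refine ⟨ψ₁, ?_, h2⟩
  have h3 : ‖ψc - ψ₁‖ ^ 2 ≤ η ^ 2 :=
    h1.trans (ENNReal.toReal_le_of_le_ofReal (by positivity) hμ.le)
  have h4 : ‖ψc - ψ₁‖ ≤ η := by
    rwa [sq_le_sq₀ (norm_nonneg _) hη0.le] at h3
  calc ‖ψ - ψ₁‖ ≤ ‖ψ - ψc‖ + ‖ψc - ψ₁‖ := norm_sub_le_norm_sub_add_norm_sub _ _ _
    _ ≤ _ := by gcongr

/-- The lower bound `⟨|X|^p⟩(K) ≥ C K ^ (α p / d)`, valid for all `0 ≤ α ≤ 1`. -/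
theorem exists_lt_cesaroAverage_moment (hd : 1 ≤ d) (φ : HilbertBasis A ℂ H)
    (U : unitary (H →L[ℂ] H)) {ψ : H} (hψ : ‖ψ‖ = 1) {α : ℝ} (hα₀ : 0 ≤ α) (hα₁ : α ≤ 1)
    (hP : alphaContinuousProjection U α ψ ≠ 0) {p : ℝ} (hp : 0 < p) :
    ∃ C : ℝ, 0 < C ∧ ∀ K : ℕ, 1 ≤ K →
      ENNReal.ofReal (C * (K : ℝ) ^ (α * p / d)) < cesaroAverage (moment U φ ψ p) K := by
  obtain ⟨r, Q, hr0, hr1, hQ, happ⟩ := exists_uniform_approx U hψ hα₀ hα₁ hP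
  have hd0 : (0 : ℝ) < d := by exact_mod_cast hd
  set s : ℝ := 1 - r ^ 2 with hs
  have hs0 : 0 < s := by rw [hs]; nlinarith
  have hs1 : s ≤ 1 := by rw [hs]; nlinarith
  -- with `t = s / 2`, the error term satisfies `(1 + t) r ^ 2 ≤ 1 - s / 2`
  set t : ℝ := s / 2 with ht
  have ht0 : 0 < t := by positivity
  set D : ℝ := (1 + 1 / t) * 3 ^ d * Q with hD
  have hD0 : 0 < D := by positivity
  -- the radius `R = c K ^ (α / d)` is such that the main term is at most `s / 4`
  set c : ℝ := (s / (4 * D)) ^ (1 / (d : ℝ)) with hc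
  have hc0 : 0 < c := by positivity
  have hcd : c ^ d = s / (4 * D) := by
    rw [hc, ← Real.rpow_natCast, ← Real.rpow_mul (by positivity), one_div_mul_cancel hd0.ne',
      Real.rpow_one]
  have hcp : 0 < c ^ p := by positivity
  refine ⟨c ^ p * (s / 8), by positivity, fun K hK => ?_⟩
  have hK0 : (0 : ℝ) < K := by exact_mod_cast hK
  have hKα : 0 < (K : ℝ) ^ α := by positivity
  set R : ℝ := c * (K : ℝ) ^ (α / d) with hR
  have hR0 : 0 < R := by positivity
  have hRp : R ^ p = c ^ p * (K : ℝ) ^ (α * p / d) := by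
    rw [hR, Real.mul_rpow hc0.le (by positivity), ← Real.rpow_mul hK0.le]
    congr 2
    ring
  have hRd : R ^ d = s / (4 * D) * (K : ℝ) ^ α := by
    rw [hR, mul_pow, hcd, ← Real.rpow_natCast, ← Real.rpow_mul hK0.le, div_mul_cancel₀ _ hd0.ne']
  have hRp0 : 0 < R ^ p := by positivity
  have hgoal : c ^ p * (s / 8) * (K : ℝ) ^ (α * p / d) = R ^ p * (s / 8) := by
    rw [hRp]; ring
  rw [hgoal]
  rcases lt_or_ge R 1 with hR1 | hR1
  · have h1 := le_cesaroAverage (f := moment U φ ψ p) (g := fun _ => 1) hK fun k => by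
      simpa using one_le_moment U φ hψ p k
    refine lt_of_lt_of_le ?_ h1
    have h2 : R ^ p ≤ 1 := Real.rpow_le_one hR0.le hR1.le hp.le
    rw [Finset.sum_const, Finset.card_range, nsmul_eq_mul, mul_one, div_self hK0.ne',
      ENNReal.ofReal_lt_ofReal_iff one_pos]
    nlinarith
  · obtain ⟨F, hFc, hF⟩ := exists_finset_latticeNorm A hR1
    obtain ⟨ψ₁, hψ₁, hret⟩ := happ K hK
    have h1 := le_cesaroAverage hK fun k => le_moment_of_finset U φ hψ hp hR0.le hF k
    refine lt_of_lt_of_le ?_ h1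
    have h2 := sum_stateProbability_le U φ ψ ψ₁ ht0 hret F
    have h3 : (1 + 1 / t) * (F.card * (Q * (K : ℝ) ^ (1 - α))) ≤ s / 4 * K := by
      calc _ ≤ (1 + 1 / t) * ((3 * R) ^ d * (Q * (K : ℝ) ^ (1 - α))) := by gcongr
        _ = D * R ^ d * (K : ℝ) ^ (1 - α) := by rw [mul_pow, hD]; ring
        _ = s / 4 * ((K : ℝ) ^ α * (K : ℝ) ^ (1 - α)) := by rw [hRd]; field_simp
        _ = s / 4 * K := by
          rw [← Real.rpow_add hK0, add_sub_cancel, Real.rpow_one]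
    have h4 : (1 + t) * (K * ‖ψ - ψ₁‖ ^ 2) ≤ (1 - s / 2) * K := by
      calc _ ≤ (1 + t) * (K * r ^ 2) := by gcongr
        _ = (1 + t) * r ^ 2 * K := by ring
        _ ≤ _ := by
          gcongr
          rw [ht]
          nlinarith
    have h5 : R ^ p * (s / 4) ≤ (∑ k ∈ Finset.range K,
        R ^ p * (1 - ∑ n ∈ F, stateProbability U φ ψ n k)) / K := by
      rw [le_div_iff₀ hK0, ← Finset.mul_sum, Finset.sum_sub_distrib, mul_assoc]
      simp only [Finset.sum_const, Finset.card_range, nsmul_eq_mul, mul_one]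
      gcongr
      linarith
    have h6 : R ^ p * (s / 8) < R ^ p * (s / 4) := by gcongr; norm_num
    rw [ENNReal.ofReal_lt_ofReal_iff (lt_of_lt_of_le (by positivity) h5)]
    linarith

end Moments

end UnitaryDynamics

theorem proposition3p4 {H : Type*} [NormedAddCommGroup H] [InnerProductSpace ℂ H]
    [CompleteSpace H] (d : ℕ) (hd : 1 ≤ d) (A : Set (Fin d → ℤ))
    (hA : A = Set.univ ∨ A = {n | ∀ i, 0 ≤ n i} ∨ A = {n | ∀ i, 1 ≤ n i})
    (φ : HilbertBasis A ℂ H) (U : unitary (H →L[ℂ] H)) (ψ : H) (hψ : ‖ψ‖ = 1)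
    (α : ℝ) (hα₀ : 0 ≤ α) (hα₁ : α ≤ 1)
    (hP : UnitaryDynamics.alphaContinuousProjection U α ψ ≠ 0) (p : ℝ) (hp : 0 < p) :
    (α < 1 → ∃ C : ℝ, 0 < C ∧ ∀ K : ℕ, 1 ≤ K →
      ENNReal.ofReal (C * (K : ℝ) ^ (α * p / d)) <
        UnitaryDynamics.cesaroAverage (UnitaryDynamics.moment U φ ψ p) K) ∧
    (α = 1 → ∃ C : ℝ, 0 < C ∧ ∀ K : ℕ, 2 ≤ K →
      ENNReal.ofReal (C * ((K : ℝ) / Real.log K) ^ (p / d)) <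
        UnitaryDynamics.cesaroAverage (UnitaryDynamics.moment U φ ψ p) K) := by
  obtain ⟨C, hC, h⟩ := UnitaryDynamics.exists_lt_cesaroAverage_moment hd φ U hψ hα₀ hα₁ hP hp
  refine ⟨fun _ => ⟨C, hC, h⟩, fun hα => ?_⟩
  have hlog2 : 0 < Real.log 2 := Real.log_pos (by norm_num)
  refine ⟨C * Real.log 2 ^ (p / d), by positivity, fun K hK => ?_⟩
  refine lt_of_le_of_lt (ENNReal.ofReal_le_ofReal ?_) (h K (by omega))
  have hK2 : (2 : ℝ) ≤ K := by exact_mod_cast hK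
  have hlogK : Real.log 2 ≤ Real.log K := Real.log_le_log (by norm_num) hK2
  rw [hα, one_mul, mul_assoc, ← Real.mul_rpow hlog2.le
    (div_nonneg (by linarith) (hlog2.le.trans hlogK))]
  gcongr
  rw [mul_div_assoc', div_le_iff₀ (hlog2.trans_le hlogK), mul_comm]
  gcongr
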